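/- Let $H$ be a separable infinite-dimensional complex Hilbert space and let $K(H)^+$ be the set of positive compact operators on $H$, with the operator norm and the usual order. For $a\in K(H)^+$ let $\lambda_1(a)\ge\lambda_2(a)\ge\cdots$ be its eigenvalue sequence: the positive eigenvalues of $a$ in decreasing order, counted with multiplicity, continued by zeros if $a$ has finite rank. For an increasing function $\alpha:\{0,1,2,\dots\}\to[0,\infty)$ with $\alpha(0)=0$, put $$\varphi_\alpha(a)=\sum_{i=1}^{\infty}\bigl(\lambda_i(a)-\lambda_{i+1}(a)\bigr)\,\alpha(i)\in[0,\infty]\qquad(a\in K(H)^+).$$ Write $\sigma(a)$ for the spectrum of $a$, $C(\sigma(a))^+$ for the set of non-negative continuous functions on $\sigma(a)$, and $f(a)$ for the continuous functional calculus. Functions $f,g$ on $\sigma(a)$ are comonotonic if $(f(s)-f(t))(g(s)-g(t))\ge 0$ for all $s,t\in\sigma(a)$. Let $\varphi:K(H)^+\to[0,\infty]$ be an arbitrary map. Then the following conditions are equivalent: (1) $\varphi=\varphi_\alpha$ for some increasing function $\alpha:\{0,1,2,\dots\}\to[0,\infty)$ with $\alpha(0)=0$. (2) $\varphi(f(a)+g(a))=\varphi(f(a))+\varphi(g(a))$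 for every $a\in K(H)^+$ and all increasing $f,g\in C(\sigma(a))^+$ with $f(0)=g(0)=0$; $\varphi$ is unitarily invariant ($\varphi(uau^*)=\varphi(a)$ for every $a\in K(H)^+$ and every unitary $u$ on $H$), monotone ($a\le b$ implies $\varphi(a)\le\varphi(b)$), positively homogeneous ($\varphi(ka)=k\varphi(a)$ for every $a\in K(H)^+$ and every real $k\ge0$, where $0\cdot\infty=0$) and lower semicontinuous on $K(H)^+$ with respect to the operator norm; and $\varphi(a)<\infty$ for every finite-rank $a\in K(H)^+$. (3) $\varphi(f(a)+g(a))=\varphi(f(a))+\varphi(g(a))$ for every $a\in K(H)^+$ and all comonotonic $f,g\in C(\sigma(a))^+$ with $f(0)=g(0)=0$; $\varphi$ is unitarily invariant, monotone, positively homogeneous and lower semicontinuous on $K(H)^+$ with respect to the operator norm; and $\varphi(a)<\infty$ for every finite-rank $a\in K(H)^+$. -/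

import Mathlib

open scoped NNReal ENNReal

noncomputable section

namespace ChoquetTrace

variable {H : Type*} [NormedAddCommGroup H] [InnerProductSpace ℂ H] [CompleteSpace H]

/-- The cone `K(H)^+` of positive compact operators on `H`, with the Loewner order and the
operator-norm topology inherited from `B(H)`. -/
def posCompact (H : Type*) [NormedAddCommGroup H] [InnerProductSpace ℂ H] [CompleteSpace H] :
    Submodule ℝ≥0 (H →L[ℂ] H) where
  carrier := {a | 0 ≤ a ∧ IsCompactOperator a}
  add_mem' := fun ha hb => ⟨add_nonneg ha.1 hb.1, ha.2.add hb.2⟩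
  zero_mem' := ⟨le_rfl, isCompactOperator_zero⟩
  smul_mem' := fun k _ ha => ⟨smul_nonneg k.2 ha.1, ha.2.smul k⟩

instance : Module ℝ≥0 (posCompact H) := (posCompact H).module

instance : SMul ℝ≥0 (posCompact H) := (posCompact H).module.toSMul

/-- `u a u*` for `a ∈ K(H)^+` and a unitary `u ∈ B(H)`. -/
def unitaryConj (u : unitary (H →L[ℂ] H)) (a : posCompact H) : posCompact H :=
  ⟨(u : H →L[ℂ] H) * (a : H →L[ℂ] H) * star (u : H →L[ℂ] H),
    star_right_conjugate_nonneg a.2.1 _,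
    (a.2.2.clm_comp (u : H →L[ℂ] H)).comp_clm (star (u : H →L[ℂ] H))⟩

/-- `f` represents an element of `C(σ(a))^+` that vanishes at `0`: it is continuous and
non-negative on the spectrum of `a` and `f 0 = 0`. Its values off `σ(a) ∪ {0}` are irrelevant. -/
structure IsPosVanishing (a : H →L[ℂ] H) (f : ℝ → ℝ) : Prop where
  continuousOn : ContinuousOn f (spectrum ℝ a)
  nonneg : ∀ x ∈ spectrum ℝ a, 0 ≤ f x
  map_zero : f 0 = 0

theorem isCompactOperator_cfc {a : H →L[ℂ] H} (ha : 0 ≤ a) (hc : IsCompactOperator a)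
    {f : ℝ → ℝ} (hf : IsPosVanishing a f) : IsCompactOperator (cfc f a : H →L[ℂ] H) := by
  have hsa : IsSelfAdjoint a := ha.isSelfAdjoint
  have hcont : ContinuousOn f (quasispectrum ℝ a) := by
    rw [quasispectrum_eq_spectrum_union_zero]
    exact hf.continuousOn.union_of_isClosed (continuousOn_singleton f 0)
      (spectrum.isClosed a) isClosed_singleton
  have hmem : cfc f a ∈ NonUnitalStarAlgebra.elemental ℝ a := by
    rw [← cfcₙ_eq_cfc hcont hf.map_zero]
    exact cfcₙ_mem_elemental f a
  have hadj : ∀ x ∈ NonUnitalStarAlgebra.adjoin ℝ ({a} : Set (H →L[ℂ] H)),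
      IsCompactOperator x ∧ IsCompactOperator (star x : H →L[ℂ] H) := by
    intro x hx
    induction hx using NonUnitalStarAlgebra.adjoin_induction with
    | mem x hx =>
      rw [Set.mem_singleton_iff] at hx
      subst hx
      exact ⟨hc, by rwa [hsa.star_eq]⟩
    | add x y _ _ hx hy =>
      exact ⟨hx.1.add hy.1, by rw [star_add]; exact hx.2.add hy.2⟩
    | zero => exact ⟨isCompactOperator_zero, by rw [star_zero]; exact isCompactOperator_zero⟩
    | mul x y _ _ hx hy =>
      exact ⟨hx.1.comp_clm y, by rw [star_mul]; exact hy.2.comp_clm (star x)⟩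
    | smul r x _ hx =>
      exact ⟨hx.1.smul r, by rw [star_smul]; exact hx.2.smul (star r)⟩
    | star x _ hx => exact ⟨hx.2, by rw [star_star]; exact hx.1⟩
  have hclosed : IsClosed {x : H →L[ℂ] H | IsCompactOperator x} :=
    isClosed_setOfPred_isCompactOperator
  exact closure_minimal (fun x hx => (hadj x hx).1) hclosed hmem

/-- The continuous functional calculus `f(a) ∈ K(H)^+` of `a ∈ K(H)^+`. -/
def funCalc (a : posCompact H) (f : ℝ → ℝ) (hf : IsPosVanishing (a : H →L[ℂ] H) f) :
    posCompact H :=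
  ⟨cfc f (a : H →L[ℂ] H), cfc_nonneg hf.nonneg, isCompactOperator_cfc a.2.1 a.2.2 hf⟩

/-- The eigenvalue sequence of `a`, indexed from `0`: `eigenvalueSeq a n` is `λ_{n+1}(a)`, the
`(n+1)`-st entry in the decreasing list of the positive eigenvalues of `a`, each repeated as often
as the dimension of its eigenspace, the list being continued by zeros if it is finite.
It is the least `t ≥ 0` such that at most `n` eigenvalues, counted with multiplicity, exceed `t`. -/
def eigenvalueSeq (a : H →L[ℂ] H) (n : ℕ) : ℝ :=
  sInf {t : ℝ | 0 ≤ t ∧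
    Module.rank ℂ ↥(⨆ μ ∈ Set.Ioi t, Module.End.eigenspace (a : H →ₗ[ℂ] H) ((μ : ℝ) : ℂ))
      ≤ (n : Cardinal)}

/-- `φ_α(a) = ∑_{i ≥ 1} (λ_i(a) - λ_{i+1}(a)) α(i)`, with the sum shifted to start at `0`. -/
def choquetTrace (α : ℕ → ℝ≥0) (a : posCompact H) : ℝ≥0∞ :=
  ∑' i : ℕ, ENNReal.ofReal (eigenvalueSeq (a : H →L[ℂ] H) i
    - eigenvalueSeq (a : H →L[ℂ] H) (i + 1)) * (α (i + 1) : ℝ≥0∞)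

/-- `f` and `g` are comonotonic on `s`. -/
def ComonotonicOn (f g : ℝ → ℝ) (s : Set ℝ) : Prop :=
  ∀ x ∈ s, ∀ y ∈ s, 0 ≤ (f x - f y) * (g x - g y)

def IsUnitarilyInvariant (φ : posCompact H → ℝ≥0∞) : Prop :=
  ∀ (u : unitary (H →L[ℂ] H)) (a : posCompact H), φ (unitaryConj u a) = φ a

/-- In `ℝ≥0∞` one has `0 * ∞ = 0`. -/
def IsPosHomogeneous (φ : posCompact H → ℝ≥0∞) : Prop :=
  ∀ (k : ℝ≥0) (a : posCompact H), φ (k • a : posCompact H) = (k : ℝ≥0∞) * φ a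

def IsMonotoneIncreasingAdditive (φ : posCompact H → ℝ≥0∞) : Prop :=
  ∀ (a : posCompact H) (f g : ℝ → ℝ)
    (hf : IsPosVanishing (a : H →L[ℂ] H) f) (hg : IsPosVanishing (a : H →L[ℂ] H) g),
    MonotoneOn f (spectrum ℝ (a : H →L[ℂ] H)) → MonotoneOn g (spectrum ℝ (a : H →L[ℂ] H)) →
      φ (funCalc a f hf + funCalc a g hg) = φ (funCalc a f hf) + φ (funCalc a g hg)

def IsComonotonicAdditive (φ : posCompact H → ℝ≥0∞) : Prop :=
  ∀ (a : posCompact H) (f g : ℝ → ℝ)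
    (hf : IsPosVanishing (a : H →L[ℂ] H) f) (hg : IsPosVanishing (a : H →L[ℂ] H) g),
    ComonotonicOn f g (spectrum ℝ (a : H →L[ℂ] H)) →
      φ (funCalc a f hf + funCalc a g hg) = φ (funCalc a f hf) + φ (funCalc a g hg)

def IsFiniteOnFiniteRank (φ : posCompact H → ℝ≥0∞) : Prop :=
  ∀ a : posCompact H,
    FiniteDimensional ℂ (LinearMap.range ((a : H →L[ℂ] H) : H →ₗ[ℂ] H)) → φ a < ∞

end ChoquetTrace

end

/-! For (1) ⇒ (3), summation by parts (`tsum_sub_succ_mul`) turns the functional into a sum of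
eigenvalues with the nonnegative weights α(i+1) − α(i), so additivity, monotonicity, homogeneity and
lower semicontinuity can be checked one eigenvalue at a time. Monotonicity and norm continuity of
each eigenvalue come from comparing quadratic forms on spectral subspaces
(`rank_le_of_quadratic_form`). Additivity is `eigenvalueSeq_funCalc_add`: comonotonic functions have
nested superlevel sets, so the eigenvalues of f(a) and g(a) add index by index.

(3) ⇒ (2) holds because two increasing functions are comonotonic. For (2) ⇒ (1), unitary invariance
makes φ depend only on the rank of a finite-rank projection, and this dependence is α. If f is
increasing and positive at only finitely many spectral points, f(a) is a layer-cake sum of multiples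
of spectral projections, all of them increasing functions of a, so additivity and homogeneity
determine φ(f(a)) (`map_funCalc_eq_of_support_finite`). A general a is the norm limit of the
operators (a − t)₊ ≤ a as t decreases to 0; lower semicontinuity of one functional and monotonicity
of the other then give an inequality between them, and exchanging roles gives equality
(`le_of_eq_on_finiteProj`). -/

noncomputable section

namespace ChoquetTrace

/-! ### Spectral subspaces and their dimensions. -/

section SpectralSubspace

variable {H : Type*} [NormedAddCommGroup H] [InnerProductSpace ℂ H]

/-- The algebraic span of the eigenspaces of `a` for the real eigenvalues in `S`. -/
def spectralSubspace (a : H →L[ℂ] H) (S : Set ℝ) : Submodule ℂ H :=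
  ⨆ μ ∈ S, Module.End.eigenspace (a : H →ₗ[ℂ] H) ((μ : ℝ) : ℂ)

theorem mem_spectralSubspace {a : H →L[ℂ] H} {S : Set ℝ} {μ : ℝ} (hμ : μ ∈ S) {x : H}
    (hx : a x = (μ : ℂ) • x) : x ∈ spectralSubspace a S :=
  Submodule.mem_iSup_of_mem μ (Submodule.mem_iSup_of_mem hμ
    (Module.End.mem_eigenspace_iff.2 hx))

theorem spectralSubspace_le {a : H →L[ℂ] H} {S : Set ℝ} {W : Submodule ℂ H}
    (h : ∀ μ ∈ S, ∀ x, a x = (μ : ℂ) • x → x ∈ W) : spectralSubspace a S ≤ W :=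
  iSup₂_le fun μ hμ x hx => h μ hμ x (Module.End.mem_eigenspace_iff.1 hx)

/-- Real eigenvalues belong to the real spectrum. -/
theorem mem_spectrum_of_apply_eq_smul {a : H →L[ℂ] H} {μ : ℝ} {x : H} (hx : x ≠ 0)
    (h : a x = (μ : ℂ) • x) : μ ∈ spectrum ℝ a := by
  rw [spectrum.mem_iff]
  rintro ⟨u, hu⟩
  apply hx
  have h0 : (u : H →L[ℂ] H) x = 0 := by
    rw [hu, sub_apply, h, Algebra.algebraMap_eq_smul_one]
    simp
  have h1 : ((↑u⁻¹ : H →L[ℂ] H) * (u : H →L[ℂ] H)) x = x := by simp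
  rw [← h1, mul_apply_eq_comp, h0, map_zero]

theorem spectralSubspace_mono {a : H →L[ℂ] H} {S S' : Set ℝ}
    (h : ∀ μ ∈ spectrum ℝ a, μ ∈ S → μ ∈ S') : spectralSubspace a S ≤ spectralSubspace a S' := by
  refine spectralSubspace_le fun μ hμ x hx => ?_
  by_cases h0 : x = 0
  · simp [h0]
  · exact mem_spectralSubspace (h μ (mem_spectrum_of_apply_eq_smul h0 hx) hμ) hx

/-- The two form bounds contradict each other on a nonzero vector of V ∩ Wᗮ, so the orthogonal
projection onto W is injective on V. This is the min-max argument behind every eigenvalue comparison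
below. -/
theorem rank_le_of_quadratic_form {T : H →L[ℂ] H} {t : ℝ} {V W : Submodule ℂ H}
    (hV : ∀ x ∈ V, x ≠ 0 → t * ‖x‖ ^ 2 < RCLike.re (inner ℂ (T x) x))
    (hW : ∀ x ∈ Wᗮ, RCLike.re (inner ℂ (T x) x) ≤ t * ‖x‖ ^ 2) {n : ℕ}
    (hn : Module.rank ℂ W ≤ n) : Module.rank ℂ V ≤ n := by
  have : FiniteDimensional ℂ W :=
    Module.rank_lt_aleph0_iff.1 (hn.trans_lt (Cardinal.natCast_lt_aleph0))
  refine le_trans (LinearMap.rank_le_of_injective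
    ((W.orthogonalProjectionOnto : H →ₗ[ℂ] W).comp V.subtype) ?_) hn
  rw [← LinearMap.ker_eq_bot, LinearMap.ker_eq_bot']
  intro x hx
  by_contra h0
  have hx' : (x : H) ∈ Wᗮ := Submodule.orthogonalProjectionOnto_eq_zero_iff.1 hx
  exact absurd (hV x x.2 (by simpa using h0)) (not_lt.2 (hW x hx'))

variable [CompleteSpace H]

/-- The functional calculus acts on eigenvectors through the eigenvalue. -/
theorem cfc_apply_of_apply_eq_smul {a : H →L[ℂ] H} (ha : IsSelfAdjoint a) {f : ℝ → ℝ}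
    (hf : ContinuousOn f (spectrum ℝ a)) {μ : ℝ} {x : H} (hx : a x = (μ : ℂ) • x) :
    cfc f a x = (f μ : ℂ) • x := by
  by_cases h0 : x = 0
  · simp [h0]
  have hμ := mem_spectrum_of_apply_eq_smul h0 hx
  rw [cfc_apply f a ha hf]
  -- Quantifying over all continuous functions on the spectrum allows Stone–Weierstrass induction;
  -- the limit step uses that both sides are continuous in F.
  suffices ∀ F : C(spectrum ℝ a, ℝ), cfcHom ha F x = ((F ⟨μ, hμ⟩ : ℝ) : ℂ) • x from this _
  intro F
  open scoped ContinuousFunctionalCalculus in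
  induction F using ContinuousMap.induction_on_of_compact with
  | const r =>
    have : ContinuousMap.const (spectrum ℝ a) r = algebraMap ℝ _ r := rfl
    rw [this, AlgHomClass.commutes, Algebra.algebraMap_eq_smul_one]
    simp
  | id => rw [cfcHom_id ha, hx]; rfl
  | star_id => rw [star_trivial, cfcHom_id ha, hx]; rfl
  | add f g hf hg => rw [map_add]; simp [hf, hg, add_smul]
  | mul f g hf hg =>
    rw [map_mul, mul_apply_eq_comp, hg, map_smul, hf, smul_smul]
    simp [mul_comm]
  | frequently f hf =>
    have hc : IsClosed {F : C(spectrum ℝ a, ℝ) |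
        cfcHom ha F x = ((F ⟨μ, hμ⟩ : ℝ) : ℂ) • x} := by
      refine isClosed_eq ?_ ?_
      · exact (ContinuousLinearMap.apply ℂ H x).continuous.comp (cfcHom_continuous ha)
      · exact (Complex.continuous_ofReal.comp
          (continuous_eval_const _)).smul continuous_const
    exact hc.closure_subset (mem_closure_iff_frequently.2 hf)

/-- Orthogonal decomposition of a vector of a spectral subspace, and the quadratic form of an
operator that is diagonal with respect to it. -/
theorem exists_sum_of_mem_spectralSubspace {a : H →L[ℂ] H} (ha : IsSelfAdjoint a) {S : Set ℝ}
    {T : H →L[ℂ] H} {g : ℝ → ℝ} (hT : ∀ (μ : ℝ) (x : H), a x = (μ : ℂ) • x → T x = (g μ : ℂ) • x)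
    {y : H} (hy : y ∈ spectralSubspace a S) :
    ∃ (s : Finset S) (w : S → H), y = ∑ μ ∈ s, w μ ∧ ‖y‖ ^ 2 = ∑ μ ∈ s, ‖w μ‖ ^ 2 ∧
      RCLike.re (inner ℂ (T y) y) = ∑ μ ∈ s, g μ * ‖w μ‖ ^ 2 := by
  classical
  have hsym : (a : H →ₗ[ℂ] H).IsSymmetric := ha.isSymmetric
  have hy' : y ∈ ⨆ μ : S, Module.End.eigenspace (a : H →ₗ[ℂ] H) ((μ : ℝ) : ℂ) := by
    rw [iSup_subtype]; exact hy
  rw [Submodule.mem_iSup_iff_exists_finsupp] at hy'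
  obtain ⟨w, hw, rfl⟩ := hy'
  have horth := hsym.orthogonalFamily_eigenspaces.comp
    (f := fun μ : S => ((μ : ℝ) : ℂ)) (Complex.ofReal_injective.comp Subtype.val_injective)
  refine ⟨w.support, w, rfl, ?_, ?_⟩
  · exact horth.norm_sum (fun μ => ⟨w μ, hw μ⟩) w.support
  · have h1 : T (w.sum fun _ x => x) = ∑ μ ∈ w.support, (g μ : ℂ) • w μ := by
      rw [Finsupp.sum, map_sum]
      exact Finset.sum_congr rfl fun μ _ => hT μ _ (Module.End.mem_eigenspace_iff.1 (hw μ))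
    have h2 := horth.inner_sum (fun μ => (g μ : ℂ) • ⟨w μ, hw μ⟩) (fun μ => ⟨w μ, hw μ⟩) w.support
    simp only [Submodule.coe_inner, SetLike.val_smul, Submodule.coe_subtypeₗᵢ,
      Submodule.coe_subtype] at h2
    rw [h1, Finsupp.sum, h2, map_sum]
    refine Finset.sum_congr rfl fun μ _ => ?_
    rw [inner_smul_left, inner_self_eq_norm_sq_to_K]
    simp [← Complex.ofReal_pow]

theorem re_inner_le_of_mem_spectralSubspace {a : H →L[ℂ] H} (ha : IsSelfAdjoint a) {S : Set ℝ}
    {T : H →L[ℂ] H} {g : ℝ → ℝ} (hT : ∀ (μ : ℝ) (x : H), a x = (μ : ℂ) • x → T x = (g μ : ℂ) • x)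
    {t : ℝ} (hg : ∀ μ ∈ S, g μ ≤ t) {y : H} (hy : y ∈ spectralSubspace a S) :
    RCLike.re (inner ℂ (T y) y) ≤ t * ‖y‖ ^ 2 := by
  obtain ⟨s, w, -, h1, h2⟩ := exists_sum_of_mem_spectralSubspace ha hT hy
  rw [h1, h2, Finset.mul_sum]
  exact Finset.sum_le_sum fun μ _ => mul_le_mul_of_nonneg_right (hg μ μ.2) (sq_nonneg _)

theorem lt_re_inner_of_mem_spectralSubspace {a : H →L[ℂ] H} (ha : IsSelfAdjoint a) {S : Set ℝ}
    {T : H →L[ℂ] H} {g : ℝ → ℝ} (hT : ∀ (μ : ℝ) (x : H), a x = (μ : ℂ) • x → T x = (g μ : ℂ) • x)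
    {t : ℝ} (hg : ∀ μ ∈ S, t < g μ) {y : H} (hy : y ∈ spectralSubspace a S) (h0 : y ≠ 0) :
    t * ‖y‖ ^ 2 < RCLike.re (inner ℂ (T y) y) := by
  obtain ⟨s, w, h, h1, h2⟩ := exists_sum_of_mem_spectralSubspace ha hT hy
  rw [h1, h2, Finset.mul_sum]
  refine Finset.sum_lt_sum
    (fun μ _ => mul_le_mul_of_nonneg_right (hg μ μ.2).le (sq_nonneg _)) ?_
  obtain ⟨μ, hμ, hne⟩ : ∃ μ ∈ s, w μ ≠ 0 := by
    by_contra! hc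
    exact h0 (h.trans (Finset.sum_eq_zero hc))
  exact ⟨μ, hμ, mul_lt_mul_of_pos_right (hg μ μ.2) (by positivity)⟩

/-- The spectral theorem for compact self-adjoint operators: after subtracting the projection onto
the closed span for Sᶜ, what remains is orthogonal to every eigenspace, hence zero. The closure is
needed because `spectralSubspace` is only an algebraic span. -/
theorem orthogonal_spectralSubspace_le {a : H →L[ℂ] H} (ha : IsSelfAdjoint a)
    (hc : IsCompactOperator a) (S : Set ℝ) :
    (spectralSubspace a S)ᗮ ≤ (spectralSubspace a Sᶜ).topologicalClosure := by
  have hsym : (a : H →ₗ[ℂ] H).IsSymmetric := ha.isSymmetric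
  intro x hx
  set K := (spectralSubspace a Sᶜ).topologicalClosure with hK
  have hKle : K ≤ (spectralSubspace a S)ᗮ := by
    refine Submodule.topologicalClosure_minimal _ ?_ (Submodule.isClosed_orthogonal _)
    refine spectralSubspace_le fun ν hν z hz => ?_
    have : spectralSubspace a S ≤ (ℂ ∙ z)ᗮ := by
      refine spectralSubspace_le fun μ hμ y hy => ?_
      rw [Submodule.mem_orthogonal_singleton_iff_inner_right]
      have hne : (ν : ℂ) ≠ (μ : ℂ) := fun h => hν (Complex.ofReal_injective h ▸ hμ)
      exact hsym.orthogonalFamily_eigenspaces hne ⟨z, Module.End.mem_eigenspace_iff.2 hz⟩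
        ⟨y, Module.End.mem_eigenspace_iff.2 hy⟩
    have h2 := Submodule.orthogonal_le this
    exact h2 (Submodule.le_orthogonal_orthogonal _ (Submodule.mem_span_singleton_self z))
  have hKc : IsClosed (K : Set H) := Submodule.isClosed_topologicalClosure _
  have : CompleteSpace K := hKc.completeSpace_coe
  set p := K.starProjection x
  have hp : p ∈ K := K.starProjection_apply_mem x
  have hq : x - p ∈ Kᗮ := K.sub_starProjection_mem_orthogonal x
  have hq' : x - p ∈ (spectralSubspace a S)ᗮ := sub_mem hx (hKle hp)
  have hall : x - p ∈ (⨆ μ : ℂ, Module.End.eigenspace (a : H →ₗ[ℂ] H) μ)ᗮ := by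
    rw [← Submodule.iInf_orthogonal, Submodule.mem_iInf]
    intro μ
    rw [Submodule.mem_orthogonal]
    intro u hu
    by_cases hu0 : u = 0
    · simp [hu0]
    have hreal : ((μ.re : ℝ) : ℂ) = μ := by
      have := hsym.conj_eigenvalue_eq_self
        (Module.End.hasEigenvalue_of_hasEigenvector ⟨hu, hu0⟩)
      exact Complex.conj_eq_iff_re.1 this
    have hu' : a u = ((μ.re : ℝ) : ℂ) • u := by
      rw [hreal]; exact Module.End.mem_eigenspace_iff.1 hu
    by_cases hS : μ.re ∈ S
    · exact (Submodule.mem_orthogonal _ _).1 hq' u (mem_spectralSubspace hS hu')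
    · exact (Submodule.mem_orthogonal _ _).1 hq u
        (Submodule.le_topologicalClosure _ (mem_spectralSubspace hS hu'))
  rw [ContinuousLinearMap.orthogonalComplement_iSup_eigenspaces_eq_bot hc hsym,
    Submodule.mem_bot, sub_eq_zero] at hall
  rw [hall]; exact hp

theorem re_inner_le_of_mem_orthogonal_spectralSubspace {a : H →L[ℂ] H} (ha : IsSelfAdjoint a)
    (hc : IsCompactOperator a) {T : H →L[ℂ] H} {g : ℝ → ℝ}
    (hT : ∀ (μ : ℝ) (x : H), a x = (μ : ℂ) • x → T x = (g μ : ℂ) • x) {t : ℝ} {x : H}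
    (hx : x ∈ (spectralSubspace a {μ | t < g μ})ᗮ) :
    RCLike.re (inner ℂ (T x) x) ≤ t * ‖x‖ ^ 2 := by
  have hx' := orthogonal_spectralSubspace_le ha hc _ hx
  have hcl : IsClosed {y : H | RCLike.re (inner ℂ (T y) y) ≤ t * ‖y‖ ^ 2} :=
    isClosed_le (by fun_prop) (by fun_prop)
  refine closure_minimal (fun y hy => ?_) hcl hx'
  exact re_inner_le_of_mem_spectralSubspace ha hT (fun μ hμ => not_lt.1 hμ) hy

/-- Both subspaces are described by the form of f(a), once through eigenvectors of f(a) and once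
through those of a. The form comparison applied in each direction bounds one rank by the other,
without identifying the eigenspaces of f(a). -/
theorem rank_spectralSubspace_cfc_le_iff {a : H →L[ℂ] H} (ha : 0 ≤ a)
    (hc : IsCompactOperator a) {f : ℝ → ℝ} (hf : IsPosVanishing a f) (t : ℝ) (n : ℕ) :
    Module.rank ℂ (spectralSubspace (cfc f a) (Set.Ioi t)) ≤ n ↔
      Module.rank ℂ (spectralSubspace a {μ | t < f μ}) ≤ n := by
  have hsa : IsSelfAdjoint a := ha.isSelfAdjoint
  have hsf : IsSelfAdjoint (cfc f a) := (cfc_nonneg hf.nonneg : 0 ≤ cfc f a).isSelfAdjoint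
  have hcf := isCompactOperator_cfc ha hc hf
  have hT : ∀ (μ : ℝ) (x : H), a x = (μ : ℂ) • x → cfc f a x = (f μ : ℂ) • x :=
    fun μ x hx => cfc_apply_of_apply_eq_smul hsa hf.continuousOn hx
  have hI : ∀ (μ : ℝ) (x : H), cfc f a x = (μ : ℂ) • x → cfc f a x = ((id μ : ℝ) : ℂ) • x :=
    fun μ x hx => hx
  constructor
  · exact rank_le_of_quadratic_form
      (fun x hx => lt_re_inner_of_mem_spectralSubspace hsa hT (fun μ hμ => hμ) hx)
      (fun x hx => re_inner_le_of_mem_orthogonal_spectralSubspace hsf hcf hI hx)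
  · exact rank_le_of_quadratic_form
      (fun x hx => lt_re_inner_of_mem_spectralSubspace hsf hI (fun μ hμ => hμ) hx)
      (fun x hx => re_inner_le_of_mem_orthogonal_spectralSubspace hsa hc hT hx)

/-- Weyl's monotonicity principle for the eigenvalue counting function. -/
theorem rank_spectralSubspace_le_of_form_le {a b : H →L[ℂ] H} (ha : 0 ≤ a) (hb : 0 ≤ b)
    (hcb : IsCompactOperator b) {s : ℝ}
    (hab : ∀ x, RCLike.re (inner ℂ (a x) x) ≤ RCLike.re (inner ℂ (b x) x) + s * ‖x‖ ^ 2)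
    (t : ℝ) (n : ℕ) (hn : Module.rank ℂ (spectralSubspace b (Set.Ioi t)) ≤ n) :
    Module.rank ℂ (spectralSubspace a (Set.Ioi (t + s))) ≤ n := by
  refine rank_le_of_quadratic_form (T := b) (t := t) (fun x hx h0 => ?_)
    (fun x hx => re_inner_le_of_mem_orthogonal_spectralSubspace hb.isSelfAdjoint hcb (g := id)
      (fun _ _ h => h) hx) hn
  have := lt_re_inner_of_mem_spectralSubspace ha.isSelfAdjoint (T := a) (g := id) (t := t + s)
    (fun _ _ h => h) (fun μ hμ => hμ) hx h0
  linarith [hab x]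

/-- On the closure of this subspace a is bounded below by t, so it restricts to a closed embedding
that is also compact. The unit ball is therefore compact, and Riesz's theorem applies. -/
theorem finiteDimensional_spectralSubspace {a : H →L[ℂ] H} (ha : 0 ≤ a)
    (hc : IsCompactOperator a) {t : ℝ} (ht : 0 < t) :
    FiniteDimensional ℂ (spectralSubspace a (Set.Ioi t)) := by
  set V := (spectralSubspace a (Set.Ioi t)).topologicalClosure with hVdef
  have hVc : IsClosed (V : Set H) := Submodule.isClosed_topologicalClosure _
  have hle : spectralSubspace a (Set.Ioi t) ≤ V := Submodule.le_topologicalClosure _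
  have hbound : ∀ x ∈ V, t * ‖x‖ ≤ ‖a x‖ := by
    have hcl : IsClosed {y : H | t * ‖y‖ ≤ ‖a y‖} := isClosed_le (by fun_prop) (by fun_prop)
    refine fun x hx => closure_minimal (fun y hy => ?_) hcl hx
    by_cases h0 : y = 0
    · simp [h0]
    have h1 := lt_re_inner_of_mem_spectralSubspace ha.isSelfAdjoint (T := a) (g := id)
      (fun _ _ h => h) (fun μ (hμ : t < μ) => hμ) hy h0
    have h2 : RCLike.re (inner ℂ (a y) y) ≤ ‖a y‖ * ‖y‖ := re_inner_le_norm _ _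
    have h3 : 0 < ‖y‖ := norm_pos_iff.2 h0
    show t * ‖y‖ ≤ ‖a y‖
    nlinarith
  have : CompleteSpace V := hVc.completeSpace_coe
  let j : V →L[ℂ] H := a.comp V.subtypeL
  have hanti : AntilipschitzWith (Real.toNNReal t⁻¹) j := by
    refine AddMonoidHomClass.antilipschitz_of_bound j fun x => ?_
    rw [Real.coe_toNNReal _ (by positivity)]
    have := hbound x x.2
    show ‖x‖ ≤ t⁻¹ * ‖a x‖
    rw [inv_mul_eq_div, le_div_iff₀ ht, mul_comm]
    exact this
  have hemb : Topology.IsClosedEmbedding j := hanti.isClosedEmbedding j.uniformContinuous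
  have hj : IsCompactOperator j := hc.comp_clm V.subtypeL
  obtain ⟨K, hK, hKs⟩ := hj.image_closedBall_subset_compact (𝕜₁ := ℂ) (f := (j : V →ₗ[ℂ] H)) 1
  have hball : IsCompact (Metric.closedBall (0 : V) 1) :=
    (hemb.isCompact_preimage hK).of_isClosed_subset Metric.isClosed_closedBall
      (Set.image_subset_iff.1 hKs)
  have : FiniteDimensional ℂ V := FiniteDimensional.of_isCompact_closedBall₀ ℂ zero_lt_one hball
  exact Submodule.finiteDimensional_of_le hle

end SpectralSubspace

/-! ### Eigenvalue sequences: comparison, continuity, comonotonic additivity. -/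

section EigenvalueSeq

variable {H : Type*} [NormedAddCommGroup H] [InnerProductSpace ℂ H]

theorem bddBelow_eigenvalueSeq_set (a : H →L[ℂ] H) (n : ℕ) :
    BddBelow {t : ℝ | 0 ≤ t ∧ Module.rank ℂ (spectralSubspace a (Set.Ioi t)) ≤ n} :=
  ⟨0, fun _ ht => ht.1⟩

theorem eigenvalueSeq_nonneg (a : H →L[ℂ] H) (n : ℕ) : 0 ≤ eigenvalueSeq a n :=
  Real.sInf_nonneg fun _ ht => ht.1

theorem eigenvalueSeq_le {a : H →L[ℂ] H} {n : ℕ} {t : ℝ} (ht : 0 ≤ t)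
    (h : Module.rank ℂ (spectralSubspace a (Set.Ioi t)) ≤ n) : eigenvalueSeq a n ≤ t :=
  csInf_le (bddBelow_eigenvalueSeq_set a n) ⟨ht, h⟩

theorem not_rank_le_of_lt_eigenvalueSeq {a : H →L[ℂ] H} {n : ℕ} {t : ℝ} (ht : 0 ≤ t)
    (h : t < eigenvalueSeq a n) : ¬ Module.rank ℂ (spectralSubspace a (Set.Ioi t)) ≤ n :=
  fun hr => (eigenvalueSeq_le ht hr).not_gt h

theorem IsPosVanishing.add {a : H →L[ℂ] H} {f g : ℝ → ℝ} (hf : IsPosVanishing a f)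
    (hg : IsPosVanishing a g) : IsPosVanishing a (fun x => f x + g x) :=
  ⟨hf.continuousOn.add hg.continuousOn, fun x hx => add_nonneg (hf.nonneg x hx) (hg.nonneg x hx),
    by simp [hf.map_zero, hg.map_zero]⟩

theorem spectralSubspace_le_range (a : H →L[ℂ] H) {t : ℝ} (ht : 0 ≤ t) :
    spectralSubspace a (Set.Ioi t) ≤ LinearMap.range (a : H →ₗ[ℂ] H) := by
  refine spectralSubspace_le fun μ hμ x hx => ⟨(μ : ℂ)⁻¹ • x, ?_⟩
  have h0 : (μ : ℂ) ≠ 0 := Complex.ofReal_ne_zero.2 (ht.trans_lt hμ).ne'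
  rw [map_smul]
  show (μ : ℂ)⁻¹ • a x = x
  rw [hx, smul_smul, inv_mul_cancel₀ h0, one_smul]

variable [CompleteSpace H]

theorem spectralSubspace_norm_eq_bot {a : H →L[ℂ] H} (ha : 0 ≤ a) :
    spectralSubspace a (Set.Ioi ‖a‖) = ⊥ := by
  rw [Submodule.eq_bot_iff]
  intro x hx
  by_contra h0
  have h1 := lt_re_inner_of_mem_spectralSubspace ha.isSelfAdjoint (T := a) (g := id)
    (fun _ _ h => h) (fun μ (hμ : ‖a‖ < μ) => hμ) hx h0
  have h2 : RCLike.re (inner ℂ (a x) x) ≤ ‖a x‖ * ‖x‖ := re_inner_le_norm _ _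
  nlinarith [a.le_opNorm x, norm_nonneg x]

/-- The threshold ‖a‖ shows that the set defining the infimum is nonempty, so the default value of
`sInf` on the empty set never intervenes. -/
theorem le_eigenvalueSeq_of_forall {a : H →L[ℂ] H} (ha : 0 ≤ a) {n : ℕ} {c : ℝ}
    (h : ∀ t, 0 ≤ t → Module.rank ℂ (spectralSubspace a (Set.Ioi t)) ≤ n → c ≤ t) :
    c ≤ eigenvalueSeq a n := by
  refine le_csInf ⟨‖a‖, norm_nonneg a, ?_⟩ fun t ht => h t ht.1 ht.2
  show Module.rank ℂ (spectralSubspace a (Set.Ioi ‖a‖)) ≤ n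
  rw [spectralSubspace_norm_eq_bot ha]
  simp

theorem le_eigenvalueSeq {a : H →L[ℂ] H} (ha : 0 ≤ a) {n : ℕ} {t : ℝ}
    (h : ¬ Module.rank ℂ (spectralSubspace a (Set.Ioi t)) ≤ n) : t ≤ eigenvalueSeq a n := by
  refine le_eigenvalueSeq_of_forall ha fun s _ hr => ?_
  by_contra! hst
  refine h (le_trans (Submodule.rank_mono (spectralSubspace_mono fun μ _ hμ => ?_)) hr)
  exact hst.trans hμ

theorem eigenvalueSeq_antitone {a : H →L[ℂ] H} (ha : 0 ≤ a) : Antitone (eigenvalueSeq a) :=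
  fun _ _ hmn => le_eigenvalueSeq_of_forall ha fun _ ht hr =>
    eigenvalueSeq_le ht (hr.trans (Nat.cast_le.2 hmn))

theorem tendsto_eigenvalueSeq {a : H →L[ℂ] H} (ha : 0 ≤ a) (hc : IsCompactOperator a) :
    Filter.Tendsto (eigenvalueSeq a) Filter.atTop (nhds 0) := by
  rw [Metric.tendsto_atTop]
  intro ε hε
  have hfin := finiteDimensional_spectralSubspace ha hc (half_pos hε)
  refine ⟨Module.finrank ℂ (spectralSubspace a (Set.Ioi (ε / 2))), fun n hn => ?_⟩
  rw [Real.dist_eq, sub_zero, abs_of_nonneg (eigenvalueSeq_nonneg a n)]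
  refine (eigenvalueSeq_le (half_pos hε).le ?_).trans_lt (half_lt_self hε)
  rw [← Module.finrank_eq_rank]
  exact Nat.cast_le.2 hn

/-- Taking s = 0 gives monotonicity in the operator, and s = ‖a − b‖ gives the Lipschitz bound. -/
theorem eigenvalueSeq_le_add {a b : H →L[ℂ] H} (ha : 0 ≤ a) (hb : 0 ≤ b)
    (hcb : IsCompactOperator b) {s : ℝ} (hs : 0 ≤ s)
    (hab : ∀ x, RCLike.re (inner ℂ (a x) x) ≤ RCLike.re (inner ℂ (b x) x) + s * ‖x‖ ^ 2)
    (n : ℕ) : eigenvalueSeq a n ≤ eigenvalueSeq b n + s := by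
  rw [← sub_le_iff_le_add]
  refine le_eigenvalueSeq_of_forall hb fun t ht hr => ?_
  rw [sub_le_iff_le_add]
  exact eigenvalueSeq_le (add_nonneg ht hs)
    (rank_spectralSubspace_le_of_form_le ha hb hcb hab t n hr)

theorem eigenvalueSeq_mono {a b : H →L[ℂ] H} (ha : 0 ≤ a) (hcb : IsCompactOperator b)
    (hab : a ≤ b) (n : ℕ) : eigenvalueSeq a n ≤ eigenvalueSeq b n := by
  have h := eigenvalueSeq_le_add ha (ha.trans hab) hcb le_rfl (fun x => ?_) n
  · simpa using h
  · have h1 := ((ContinuousLinearMap.le_def a b).1 hab).re_inner_nonneg_left x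
    rw [sub_apply, inner_sub_left, map_sub] at h1
    linarith

theorem abs_eigenvalueSeq_sub_le {a b : H →L[ℂ] H} (ha : 0 ≤ a) (hca : IsCompactOperator a)
    (hb : 0 ≤ b) (hcb : IsCompactOperator b) (n : ℕ) :
    |eigenvalueSeq a n - eigenvalueSeq b n| ≤ ‖a - b‖ := by
  have key : ∀ {c d : H →L[ℂ] H} (x : H), RCLike.re (inner ℂ (c x) x) ≤
      RCLike.re (inner ℂ (d x) x) + ‖c - d‖ * ‖x‖ ^ 2 := by
    intro c d x
    have h1 : RCLike.re (inner ℂ ((c - d) x) x) ≤ ‖(c - d) x‖ * ‖x‖ := re_inner_le_norm _ _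
    have h2 := (c - d).le_opNorm x
    rw [sub_apply, inner_sub_left, map_sub, ← sub_apply] at h1
    nlinarith [norm_nonneg x]
  rw [abs_sub_le_iff]
  constructor
  · linarith [eigenvalueSeq_le_add ha hb hcb (norm_nonneg (a - b)) key n]
  · have := eigenvalueSeq_le_add hb ha hca (norm_nonneg (b - a)) key n
    rw [norm_sub_rev] at this
    linarith

theorem continuous_eigenvalueSeq (n : ℕ) :
    Continuous fun a : posCompact H => eigenvalueSeq (a : H →L[ℂ] H) n := by
  refine LipschitzWith.continuous (K := 1) (LipschitzWith.of_dist_le_mul fun a b => ?_)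
  rw [NNReal.coe_one, one_mul, Real.dist_eq, Subtype.dist_eq, dist_eq_norm]
  exact abs_eigenvalueSeq_sub_le a.2.1 a.2.2 b.2.1 b.2.2 n

theorem eigenvalueSeq_unitaryConj_le (u : unitary (H →L[ℂ] H)) (a : posCompact H) (n : ℕ) :
    eigenvalueSeq (unitaryConj u a : H →L[ℂ] H) n ≤ eigenvalueSeq (a : H →L[ℂ] H) n := by
  refine le_eigenvalueSeq_of_forall a.2.1 fun t ht hr => eigenvalueSeq_le ht ?_
  have huu : ∀ x, (u : H →L[ℂ] H) (star (u : H →L[ℂ] H) x) = x := fun x => by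
    rw [← mul_apply_eq_comp, Unitary.mul_star_self_of_mem u.2]; rfl
  have huu' : ∀ x, star (u : H →L[ℂ] H) ((u : H →L[ℂ] H) x) = x := fun x => by
    rw [← mul_apply_eq_comp, Unitary.star_mul_self_of_mem u.2]; rfl
  have hle : spectralSubspace (unitaryConj u a : H →L[ℂ] H) (Set.Ioi t) ≤
      (spectralSubspace (a : H →L[ℂ] H) (Set.Ioi t)).map ((u : H →L[ℂ] H) : H →ₗ[ℂ] H) := by
    refine spectralSubspace_le fun μ hμ x hx => ?_
    refine ⟨star (u : H →L[ℂ] H) x, mem_spectralSubspace hμ ?_, huu x⟩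
    have hx' : (u : H →L[ℂ] H) ((a : H →L[ℂ] H) (star (u : H →L[ℂ] H) x)) = (μ : ℂ) • x := hx
    rw [← huu' ((a : H →L[ℂ] H) (star (u : H →L[ℂ] H) x)), hx', map_smul]
  exact ((Submodule.rank_mono hle).trans (rank_map_le _ _)).trans hr

theorem unitaryConj_star_unitaryConj (u : unitary (H →L[ℂ] H)) (a : posCompact H) :
    unitaryConj (star u) (unitaryConj u a) = a := by
  apply Subtype.ext
  show star (u : H →L[ℂ] H) * (u * a * star (u : H →L[ℂ] H)) * star (star (u : H →L[ℂ] H)) = a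
  rw [star_star, mul_assoc, mul_assoc, Unitary.coe_star_mul_self, mul_one, ← mul_assoc,
    Unitary.coe_star_mul_self, one_mul]

theorem eigenvalueSeq_unitaryConj (u : unitary (H →L[ℂ] H)) (a : posCompact H) (n : ℕ) :
    eigenvalueSeq (unitaryConj u a : H →L[ℂ] H) n = eigenvalueSeq (a : H →L[ℂ] H) n := by
  refine le_antisymm (eigenvalueSeq_unitaryConj_le u a n) ?_
  have := eigenvalueSeq_unitaryConj_le (star u) (unitaryConj u a) n
  rwa [unitaryConj_star_unitaryConj] at this

theorem coe_nnreal_smul_apply (k : ℝ≥0) (a : posCompact H) (x : H) :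
    ((k • a : posCompact H) : H →L[ℂ] H) x = ((k : ℝ) : ℂ) • (a : H →L[ℂ] H) x := rfl

theorem eigenvalueSeq_smul_le {k : ℝ≥0} (hk : 0 < k) (a : posCompact H) (n : ℕ) :
    eigenvalueSeq ((k • a : posCompact H) : H →L[ℂ] H) n ≤ k * eigenvalueSeq (a : H →L[ℂ] H) n := by
  have hk' : (0 : ℝ) < k := hk
  rw [← div_le_iff₀' hk']
  refine le_eigenvalueSeq_of_forall a.2.1 fun t ht hr => ?_
  rw [div_le_iff₀' hk']
  refine eigenvalueSeq_le (by positivity) (le_trans (Submodule.rank_mono ?_) hr)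
  refine spectralSubspace_le fun μ hμ x hx => mem_spectralSubspace (μ := (k : ℝ)⁻¹ * μ) ?_ ?_
  · rw [Set.mem_Ioi, inv_mul_eq_div, lt_div_iff₀' hk']
    exact hμ
  · rw [coe_nnreal_smul_apply] at hx
    rw [Complex.ofReal_mul, mul_smul, ← hx, smul_smul, ← Complex.ofReal_mul,
      inv_mul_cancel₀ hk'.ne', Complex.ofReal_one, one_smul]

theorem eigenvalueSeq_zero (n : ℕ) : eigenvalueSeq (0 : H →L[ℂ] H) n = 0 := by
  refine le_antisymm (eigenvalueSeq_le le_rfl ?_) (eigenvalueSeq_nonneg _ _)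
  have := spectralSubspace_norm_eq_bot (a := (0 : H →L[ℂ] H)) le_rfl
  rw [norm_zero] at this
  rw [this]
  simp

theorem eigenvalueSeq_smul (k : ℝ≥0) (a : posCompact H) (n : ℕ) :
    eigenvalueSeq ((k • a : posCompact H) : H →L[ℂ] H) n = k * eigenvalueSeq (a : H →L[ℂ] H) n := by
  rcases eq_or_ne k 0 with rfl | hk
  · rw [zero_smul]
    simpa using eigenvalueSeq_zero n
  have hk0 : 0 < k := pos_iff_ne_zero.2 hk
  refine le_antisymm (eigenvalueSeq_smul_le hk0 a n) ?_
  have h := eigenvalueSeq_smul_le (inv_pos.2 hk0) (k • a) n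
  have hinv : k⁻¹ • (k • a) = a := by
    refine Subtype.ext (ContinuousLinearMap.ext fun x => ?_)
    rw [coe_nnreal_smul_apply, coe_nnreal_smul_apply, smul_smul, ← Complex.ofReal_mul,
      NNReal.coe_inv, inv_mul_cancel₀ (NNReal.coe_ne_zero.2 hk), Complex.ofReal_one, one_smul]
  rw [hinv, NNReal.coe_inv, inv_mul_eq_div,
    le_div_iff₀' (by exact_mod_cast hk0)] at h
  exact h

theorem funCalc_add (a : posCompact H) {f g : ℝ → ℝ} (hf : IsPosVanishing (a : H →L[ℂ] H) f)
    (hg : IsPosVanishing (a : H →L[ℂ] H) g) :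
    funCalc a (fun x => f x + g x) (hf.add hg) = funCalc a f hf + funCalc a g hg :=
  Subtype.ext (cfc_add (a := (a : H →L[ℂ] H)) f g hf.continuousOn hg.continuousOn)

/-- The superlevel sets of comonotonic functions are nested. -/
theorem ComonotonicOn.superlevel_nested {f g : ℝ → ℝ} {σ : Set ℝ} (h : ComonotonicOn f g σ)
    (t s : ℝ) : (∀ x ∈ σ, t < f x → s < g x) ∨ (∀ x ∈ σ, s < g x → t < f x) := by
  by_contra! hc
  obtain ⟨⟨x, hx, hfx, hgx⟩, y, hy, hgy, hfy⟩ := hc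
  have := h x hx y hy
  nlinarith [mul_pos (sub_pos.2 (hfy.trans_lt hfx)) (sub_pos.2 (hgx.trans_lt hgy))]

/-- Since {f + g > t + s} lies in {f > t} ∪ {g > s} and contains {f > t} ∩ {g > s}, nestedness
reduces the union and the intersection to one of the two sets. The union gives the upper bound, the
intersection the lower one. -/
theorem eigenvalueSeq_funCalc_add (a : posCompact H) {f g : ℝ → ℝ}
    (hf : IsPosVanishing (a : H →L[ℂ] H) f) (hg : IsPosVanishing (a : H →L[ℂ] H) g)
    (hfg : ComonotonicOn f g (spectrum ℝ (a : H →L[ℂ] H))) (n : ℕ) :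
    eigenvalueSeq ((funCalc a f hf + funCalc a g hg : posCompact H) : H →L[ℂ] H) n =
      eigenvalueSeq (funCalc a f hf : H →L[ℂ] H) n +
        eigenvalueSeq (funCalc a g hg : H →L[ℂ] H) n := by
  have hrank : ∀ {h : ℝ → ℝ} (hh : IsPosVanishing (a : H →L[ℂ] H) h) (t : ℝ),
      Module.rank ℂ (spectralSubspace (funCalc a h hh : H →L[ℂ] H) (Set.Ioi t)) ≤ n ↔
      Module.rank ℂ (spectralSubspace (a : H →L[ℂ] H) {μ | t < h μ}) ≤ n :=
    fun hh t => rank_spectralSubspace_cfc_le_iff a.2.1 a.2.2 hh t n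
  apply le_antisymm
  · rw [← sub_le_iff_le_add]
    refine le_eigenvalueSeq_of_forall (funCalc a f hf).2.1 fun t ht hr => ?_
    rw [sub_le_comm]
    refine le_eigenvalueSeq_of_forall (funCalc a g hg).2.1 fun s hs hr' => ?_
    rw [sub_le_iff_le_add', ← funCalc_add]
    rw [hrank] at hr hr'
    refine eigenvalueSeq_le (add_nonneg ht hs) ((hrank _ _).2 ?_)
    rcases hfg.superlevel_nested t s with h | h
    · refine (Submodule.rank_mono (spectralSubspace_mono fun μ hμ hlt => ?_)).trans hr'
      by_contra hle
      have h1 : f μ ≤ t := not_lt.1 fun h2 => hle (h μ hμ h2)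
      exact absurd hlt (not_lt.2 (add_le_add h1 (not_lt.1 hle)))
    · refine (Submodule.rank_mono (spectralSubspace_mono fun μ hμ hlt => ?_)).trans hr
      by_contra hle
      have h1 : g μ ≤ s := not_lt.1 fun h2 => hle (h μ hμ h2)
      exact absurd hlt (not_lt.2 (add_le_add (not_lt.1 hle) h1))
  · rcases (eigenvalueSeq_nonneg (funCalc a f hf : H →L[ℂ] H) n).eq_or_lt with h0 | h0
    · rw [← h0, zero_add]
      exact eigenvalueSeq_mono (funCalc a g hg).2.1 (funCalc a f hf + funCalc a g hg).2.2
        (le_add_of_nonneg_left (funCalc a f hf).2.1) n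
    rcases (eigenvalueSeq_nonneg (funCalc a g hg : H →L[ℂ] H) n).eq_or_lt with h1 | h1
    · rw [← h1, add_zero]
      exact eigenvalueSeq_mono (funCalc a f hf).2.1 (funCalc a f hf + funCalc a g hg).2.2
        (le_add_of_nonneg_right (funCalc a g hg).2.1) n
    rw [← le_sub_iff_add_le]
    refine le_of_forall_lt_imp_le_of_dense fun t' ht' => ?_
    rw [le_sub_comm]
    refine le_of_forall_lt_imp_le_of_dense fun s' hs' => ?_
    rw [le_sub_iff_add_le']
    -- The approximants t', s' may be negative, while thresholds must be nonnegative. Both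
    -- eigenvalues are positive here, so truncating at 0 keeps the thresholds strictly below them.
    refine (add_le_add (le_max_left t' 0) (le_max_left s' 0)).trans ?_
    have ht := not_rank_le_of_lt_eigenvalueSeq (le_max_right t' 0) (max_lt ht' h0)
    have hs := not_rank_le_of_lt_eigenvalueSeq (le_max_right s' 0) (max_lt hs' h1)
    rw [hrank] at ht hs
    rw [← funCalc_add]
    refine le_eigenvalueSeq (funCalc a _ (hf.add hg)).2.1 fun hr => ?_
    rw [hrank] at hr
    rcases hfg.superlevel_nested (max t' 0) (max s' 0) with h | h
    · exact ht ((Submodule.rank_mono (spectralSubspace_mono fun μ hμ hlt =>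
        add_lt_add hlt (h μ hμ hlt))).trans hr)
    · exact hs ((Submodule.rank_mono (spectralSubspace_mono fun μ hμ hlt =>
        add_lt_add (h μ hμ hlt) hlt)).trans hr)

/-! ### The functionals φ_α satisfy condition (3). -/

/-- Summation by parts in `ℝ≥0∞`. -/
theorem tsum_sub_succ_mul {l : ℕ → ℝ} (hl : Antitone l)
    (hl0 : Filter.Tendsto l Filter.atTop (nhds 0)) {α : ℕ → ℝ≥0} (hα : Monotone α)
    (hα0 : α 0 = 0) :
    ∑' i, ENNReal.ofReal (l i - l (i + 1)) * (α (i + 1) : ℝ≥0∞) =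
      ∑' i, ENNReal.ofReal (l i) * ((α (i + 1) - α i : ℝ≥0) : ℝ≥0∞) := by
  have hd : ∀ i, 0 ≤ l i - l (i + 1) := fun i => sub_nonneg.2 (hl i.le_succ)
  have htel : ∀ j, ∑' i, ENNReal.ofReal (l (i + j) - l (i + j + 1)) = ENNReal.ofReal (l j) := by
    intro j
    have h1 : HasSum (fun i => l (i + j) - l (i + j + 1)) (l j) := by
      rw [hasSum_iff_tendsto_nat_of_nonneg fun i => hd (i + j)]
      have h2 : ∀ n, ∑ i ∈ Finset.range n, (l (i + j) - l (i + j + 1)) = l j - l (n + j) := by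
        intro n
        have := Finset.sum_range_sub' (fun i => l (i + j)) n
        simp only [zero_add] at this
        rw [← this]
        exact Finset.sum_congr rfl fun i _ => by rw [add_right_comm]
      simp only [h2]
      simpa using tendsto_const_nhds.sub ((Filter.tendsto_add_atTop_iff_nat j).2 hl0)
    rw [← ENNReal.ofReal_tsum_of_nonneg (fun i => hd (i + j)) h1.summable, h1.tsum_eq]
  -- Writing α(i+1) as the sum of its increments, which uses α(0) = 0, produces a double sum whose
  -- order is then exchanged.
  have hsum : ∀ i, (α (i + 1) : ℝ≥0∞) =
      ∑' j, if j ≤ i then ((α (j + 1) - α j : ℝ≥0) : ℝ≥0∞) else 0 := by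
    intro i
    rw [tsum_eq_sum (s := Finset.range (i + 1)) (fun j hj => if_neg (by simpa using hj)),
      Finset.sum_congr rfl fun j hj => if_pos (by simpa [Nat.lt_succ_iff] using hj),
      ← ENNReal.ofNNReal_finsetSum, Finset.sum_range_tsub hα, hα0, tsub_zero]
  have htail : ∀ j, ∑' i, (if j ≤ i then ENNReal.ofReal (l i - l (i + 1)) else 0) =
      ENNReal.ofReal (l j) := by
    intro j
    rw [← htel j, ← Summable.sum_add_tsum_nat_add' (k := j) ENNReal.summable,
      Finset.sum_eq_zero (fun i hi => if_neg (by simpa using hi)), zero_add]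
    exact tsum_congr fun i => if_pos (Nat.le_add_left j i)
  calc ∑' i, ENNReal.ofReal (l i - l (i + 1)) * (α (i + 1) : ℝ≥0∞)
      = ∑' i, ∑' j, (if j ≤ i then ENNReal.ofReal (l i - l (i + 1)) else 0) *
          ((α (j + 1) - α j : ℝ≥0) : ℝ≥0∞) := by
        refine tsum_congr fun i => ?_
        rw [hsum, ← ENNReal.tsum_mul_left]
        exact tsum_congr fun j => by split_ifs <;> simp
    _ = _ := by
        rw [ENNReal.tsum_comm]
        exact tsum_congr fun j => by rw [ENNReal.tsum_mul_right, htail]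

section choquetTrace

variable {α : ℕ → ℝ≥0}

theorem choquetTrace_eq_tsum (hα : Monotone α) (hα0 : α 0 = 0) (a : posCompact H) :
    choquetTrace α a = ∑' i, ENNReal.ofReal (eigenvalueSeq (a : H →L[ℂ] H) i) *
      ((α (i + 1) - α i : ℝ≥0) : ℝ≥0∞) :=
  tsum_sub_succ_mul (eigenvalueSeq_antitone a.2.1) (tendsto_eigenvalueSeq a.2.1 a.2.2) hα hα0

theorem isComonotonicAdditive_choquetTrace (hα : Monotone α) (hα0 : α 0 = 0) :
    IsComonotonicAdditive (choquetTrace α : posCompact H → ℝ≥0∞) := by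
  intro a f g hf hg hfg
  simp only [choquetTrace_eq_tsum hα hα0]
  rw [← ENNReal.tsum_add]
  refine tsum_congr fun i => ?_
  rw [eigenvalueSeq_funCalc_add a hf hg hfg, ENNReal.ofReal_add (eigenvalueSeq_nonneg _ _)
    (eigenvalueSeq_nonneg _ _), add_mul]

theorem isUnitarilyInvariant_choquetTrace :
    IsUnitarilyInvariant (choquetTrace α : posCompact H → ℝ≥0∞) := by
  intro u a
  simp only [choquetTrace, eigenvalueSeq_unitaryConj]

theorem monotone_choquetTrace (hα : Monotone α) (hα0 : α 0 = 0) :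
    Monotone (choquetTrace α : posCompact H → ℝ≥0∞) := by
  intro a b hab
  simp only [choquetTrace_eq_tsum hα hα0]
  exact ENNReal.tsum_le_tsum fun i => mul_le_mul_left
    (ENNReal.ofReal_le_ofReal (eigenvalueSeq_mono a.2.1 b.2.2 hab i)) _

theorem isPosHomogeneous_choquetTrace (hα : Monotone α) (hα0 : α 0 = 0) :
    IsPosHomogeneous (choquetTrace α : posCompact H → ℝ≥0∞) := by
  intro k a
  simp only [choquetTrace_eq_tsum hα hα0]
  rw [← ENNReal.tsum_mul_left]
  refine tsum_congr fun i => ?_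
  rw [eigenvalueSeq_smul, ENNReal.ofReal_mul k.coe_nonneg, ENNReal.ofReal_coe_nnreal, mul_assoc]

theorem lowerSemicontinuous_choquetTrace (hα : Monotone α) (hα0 : α 0 = 0) :
    LowerSemicontinuous (choquetTrace α : posCompact H → ℝ≥0∞) := by
  have : (choquetTrace α : posCompact H → ℝ≥0∞) = fun a : posCompact H => ∑' i,
      ENNReal.ofReal (eigenvalueSeq (a : H →L[ℂ] H) i) * ((α (i + 1) - α i : ℝ≥0) : ℝ≥0∞) :=
    funext (choquetTrace_eq_tsum hα hα0)
  rw [this]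
  refine lowerSemicontinuous_tsum fun i => Continuous.lowerSemicontinuous ?_
  exact (ENNReal.continuous_mul_const ENNReal.coe_ne_top).comp
    (ENNReal.continuous_ofReal.comp (continuous_eigenvalueSeq i))

theorem isFiniteOnFiniteRank_choquetTrace :
    IsFiniteOnFiniteRank (choquetTrace α : posCompact H → ℝ≥0∞) := by
  intro a hfin
  have h0 : ∀ n, Module.finrank ℂ (LinearMap.range ((a : H →L[ℂ] H) : H →ₗ[ℂ] H)) ≤ n →
      eigenvalueSeq (a : H →L[ℂ] H) n = 0 := by
    intro n hn
    refine le_antisymm (eigenvalueSeq_le le_rfl ?_) (eigenvalueSeq_nonneg _ _)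
    refine (Submodule.rank_mono (spectralSubspace_le_range _ le_rfl)).trans ?_
    rw [← Module.finrank_eq_rank]
    exact Nat.cast_le.2 hn
  rw [choquetTrace, tsum_eq_sum (s := Finset.range
    (Module.finrank ℂ (LinearMap.range ((a : H →L[ℂ] H) : H →ₗ[ℂ] H))))]
  · exact ENNReal.sum_lt_top.2 fun i _ => ENNReal.mul_lt_top ENNReal.ofReal_lt_top
      ENNReal.coe_lt_top
  · intro i hi
    have hi' := not_lt.1 (mt Finset.mem_range.2 hi)
    rw [h0 i hi', h0 (i + 1) (hi'.trans i.le_succ)]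
    simp

end choquetTrace

end EigenvalueSeq

/-! ### Finite-rank projections and unitary equivalence. -/

section Uniqueness

variable {H : Type*} [NormedAddCommGroup H] [InnerProductSpace ℂ H]

/-- The spaces are nested so that the values of φ on their projections form a monotone α. -/
theorem exists_flag (hH : ¬ FiniteDimensional ℂ H) :
    ∃ M : ℕ → Submodule ℂ H, Monotone M ∧ (∀ n, FiniteDimensional ℂ (M n)) ∧
      ∀ n, Module.finrank ℂ (M n) = n := by
  let b := Module.Basis.ofVectorSpace ℂ H
  have hinf : Infinite (Module.Basis.ofVectorSpaceIndex ℂ H) := by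
    by_contra hfin
    rw [not_infinite_iff_finite] at hfin
    exact hH (Module.Finite.of_basis b)
  let v : ℕ → H := fun n => b (Infinite.natEmbedding _ n)
  have hv : LinearIndependent ℂ v :=
    b.linearIndependent.comp _ (Infinite.natEmbedding _).injective
  have hspan : ∀ n, v '' Set.Iio n = Set.range fun i : Fin n => v i := by
    intro n
    ext x
    constructor
    · rintro ⟨i, hi, rfl⟩
      exact ⟨⟨i, hi⟩, rfl⟩
    · rintro ⟨i, rfl⟩
      exact ⟨i, i.2, rfl⟩
  refine ⟨fun n => Submodule.span ℂ (v '' Set.Iio n), fun m n hmn =>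
    Submodule.span_mono (Set.image_mono (Set.Iio_subset_Iio hmn)), fun n =>
    FiniteDimensional.span_of_finite ℂ ((Set.finite_Iio n).image v), fun n => ?_⟩
  show Module.finrank ℂ (Submodule.span ℂ (v '' Set.Iio n)) = n
  rw [hspan]
  exact (finrank_span_eq_card (hv.comp _ Fin.val_injective)).trans (Fintype.card_fin n)

theorem isCompactOperator_starProjection (M : Submodule ℂ H) [FiniteDimensional ℂ M] :
    IsCompactOperator M.starProjection := by
  have := (isCompactOperator_id (E := M)).comp_clm M.orthogonalProjectionOnto
  exact this.clm_comp M.subtypeL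

/-- An isometry from M onto N extends to a unitary of the finite-dimensional space M ⊔ N; adding the
identity on the orthogonal complement gives a unitary of H. -/
theorem exists_linearIsometryEquiv_map_eq {M N : Submodule ℂ H} [FiniteDimensional ℂ M]
    [FiniteDimensional ℂ N] (h : Module.finrank ℂ M = Module.finrank ℂ N) :
    ∃ e : H ≃ₗᵢ[ℂ] H, M.map (e.toLinearEquiv : H →ₗ[ℂ] H) = N := by
  let F := M ⊔ N
  let M' : Submodule ℂ F := M.comap F.subtype
  let j : M' →ₗᵢ[ℂ] M :=
    { toFun := fun x => ⟨x, x.2⟩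
      map_add' := fun _ _ => rfl
      map_smul' := fun _ _ => rfl
      norm_map' := fun _ => rfl }
  let k : N →ₗᵢ[ℂ] F :=
    { toFun := fun x => ⟨x, (le_sup_right : N ≤ M ⊔ N) x.2⟩
      map_add' := fun _ _ => rfl
      map_smul' := fun _ _ => rfl
      norm_map' := fun _ => rfl }
  let w : M ≃ₗᵢ[ℂ] N := (stdOrthonormalBasis ℂ M).equiv (stdOrthonormalBasis ℂ N) (finCongr h)
  let V : F ≃ₗᵢ[ℂ] F :=
    (LinearIsometry.extend (k.comp (w.toLinearIsometry.comp j))).toLinearIsometryEquiv rfl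
  have hV : ∀ x (hx : x ∈ M), (V ⟨x, (le_sup_left : M ≤ M ⊔ N) hx⟩ : H) ∈ N := by
    intro x hx
    have : V ⟨x, (le_sup_left : M ≤ M ⊔ N) hx⟩ = k (w ⟨x, hx⟩) :=
      LinearIsometry.extend_apply (k.comp (w.toLinearIsometry.comp j))
        ⟨⟨x, (le_sup_left : M ≤ M ⊔ N) hx⟩, hx⟩
    rw [this]
    exact (w ⟨x, hx⟩).2
  let P : H →ₗ[ℂ] F := F.orthogonalProjectionOnto
  let U : H →ₗ[ℂ] H :=
    F.subtype ∘ₗ (V.toLinearEquiv : F →ₗ[ℂ] F) ∘ₗ P + (LinearMap.id - F.subtype ∘ₗ P)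
  have hU : ∀ x, U x = (V (P x) : H) + (x - P x) := fun _ => rfl
  have hq : ∀ x, x - (P x : H) ∈ Fᗮ := fun x => F.sub_starProjection_mem_orthogonal x
  have hP : ∀ (y : F) (z : H), z ∈ Fᗮ → P (y + z) = y := by
    intro y z hz
    rw [map_add]
    have h1 : P (y : H) = y := Submodule.orthogonalProjectionOnto_mem_subspace_eq_self y
    have h2 : P z = 0 := Submodule.orthogonalProjectionOnto_eq_zero_iff.2 hz
    rw [h1, h2, add_zero]
  have hnorm : ∀ x, ‖U x‖ = ‖x‖ := by
    intro x
    have key : ∀ y : F, ‖(y : H) + (x - P x)‖ * ‖(y : H) + (x - P x)‖ =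
        ‖y‖ * ‖y‖ + ‖x - P x‖ * ‖x - P x‖ := fun y =>
      norm_add_sq_eq_norm_sq_add_norm_sq_of_inner_eq_zero _ _
        ((Submodule.mem_orthogonal _ _).1 (hq x) y y.2)
    have h1 := key (V (P x))
    have h2 := key (P x)
    rw [V.norm_map, ← h2, add_sub_cancel, ← hU] at h1
    exact (mul_self_inj (norm_nonneg _) (norm_nonneg _)).1 h1
  let Ui : H →ₗᵢ[ℂ] H := ⟨U, hnorm⟩
  have hsurj : Function.Surjective Ui := by
    intro y
    refine ⟨(V.symm (P y) : H) + (y - P y), ?_⟩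
    show U _ = y
    rw [hU, hP _ _ (hq y), V.apply_symm_apply]
    abel
  let e : H ≃ₗᵢ[ℂ] H := LinearIsometryEquiv.ofSurjective Ui hsurj
  refine ⟨e, Submodule.eq_of_le_of_finrank_eq ?_ ?_⟩
  · rintro _ ⟨x, hx, rfl⟩
    show U x ∈ N
    have hxF : x ∈ F := (le_sup_left : M ≤ M ⊔ N) hx
    have h1 : P x = ⟨x, hxF⟩ := Submodule.orthogonalProjectionOnto_mem_subspace_eq_self ⟨x, hxF⟩
    rw [hU, h1, sub_self, add_zero]
    exact hV x hx
  · rw [LinearEquiv.finrank_map_eq, h]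

variable [CompleteSpace H]

/-- The orthogonal projection onto a finite-dimensional subspace, as an element of `K(H)^+`. -/
def finiteProj (M : Submodule ℂ H) [FiniteDimensional ℂ M] : posCompact H :=
  ⟨M.starProjection, (isStarProjection_starProjection (U := M)).nonneg,
    isCompactOperator_starProjection M⟩

theorem finiteProj_mono {M N : Submodule ℂ H} [FiniteDimensional ℂ M] [FiniteDimensional ℂ N]
    (h : M ≤ N) : finiteProj M ≤ finiteProj N :=
  Submodule.starProjection_le_starProjection_iff.2 h

theorem eigenvalueSeq_finiteProj (M : Submodule ℂ H) [FiniteDimensional ℂ M] (i : ℕ) :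
    eigenvalueSeq (finiteProj M : H →L[ℂ] H) i = if i < Module.finrank ℂ M then 1 else 0 := by
  split_ifs with hi
  · apply le_antisymm
    · refine (eigenvalueSeq_le (norm_nonneg _) ?_).trans M.starProjection_norm_le
      show Module.rank ℂ (spectralSubspace (finiteProj M : H →L[ℂ] H)
        (Set.Ioi ‖(finiteProj M : H →L[ℂ] H)‖)) ≤ i
      rw [spectralSubspace_norm_eq_bot (finiteProj M).2.1]
      simp
    · refine le_eigenvalueSeq_of_forall (finiteProj M).2.1 fun t _ hr => ?_
      by_contra! ht
      have hle : M ≤ spectralSubspace (finiteProj M : H →L[ℂ] H) (Set.Ioi t) := fun x hx =>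
        mem_spectralSubspace (μ := 1) ht (by
          rw [Complex.ofReal_one, one_smul]
          exact Submodule.starProjection_eq_self_iff.2 hx)
      have := (Submodule.rank_mono hle).trans hr
      rw [← Module.finrank_eq_rank, Nat.cast_le] at this
      omega
  · refine le_antisymm (eigenvalueSeq_le le_rfl ?_) (eigenvalueSeq_nonneg _ _)
    have hle : spectralSubspace (finiteProj M : H →L[ℂ] H) (Set.Ioi 0) ≤ M := by
      refine (spectralSubspace_le_range _ le_rfl).trans ?_
      rintro _ ⟨x, rfl⟩
      exact M.starProjection_apply_mem x
    refine (Submodule.rank_mono hle).trans ?_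
    rw [← Module.finrank_eq_rank, Nat.cast_le]
    omega

/-- The only nonzero eigenvalue gap occurs at index rank − 1, where the shifted weight is α(rank).
Rank zero has no gap, hence the need for α(0) = 0. -/
theorem choquetTrace_finiteProj {α : ℕ → ℝ≥0} (hα0 : α 0 = 0) (M : Submodule ℂ H)
    [FiniteDimensional ℂ M] : choquetTrace α (finiteProj M) = α (Module.finrank ℂ M) := by
  simp only [choquetTrace, eigenvalueSeq_finiteProj]
  rcases hn : Module.finrank ℂ M with _ | m
  · simp [hα0]
  · rw [tsum_eq_single m]
    · simp
    · intro i hi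
      rcases lt_or_gt_of_ne hi with h | h
      · rw [if_pos (by omega), if_pos (by omega)]; simp
      · rw [if_neg (by omega), if_neg (by omega)]; simp

/-- Finite-rank projections of equal rank are unitarily equivalent. -/
theorem exists_unitaryConj_finiteProj_eq {M N : Submodule ℂ H} [FiniteDimensional ℂ M]
    [FiniteDimensional ℂ N] (h : Module.finrank ℂ M = Module.finrank ℂ N) :
    ∃ u : unitary (H →L[ℂ] H), unitaryConj u (finiteProj M) = finiteProj N := by
  obtain ⟨e, he⟩ := exists_linearIsometryEquiv_map_eq h
  subst he
  let u : unitary (H →L[ℂ] H) := Unitary.linearIsometryEquiv.symm e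
  have hu : ∀ x, star (u : H →L[ℂ] H) x = e.symm x := fun x => by
    rw [LinearIsometryEquiv.eq_symm_apply]
    show ((u : H →L[ℂ] H) * star (u : H →L[ℂ] H)) x = x
    rw [Unitary.mul_star_self_of_mem u.2]
    rfl
  refine ⟨u, Subtype.ext (ContinuousLinearMap.ext fun x => ?_)⟩
  show e (M.starProjection (star (u : H →L[ℂ] H) x)) = _
  rw [hu]
  exact (Submodule.starProjection_map_apply e M x).symm

theorem exists_funCalc_eq_finiteProj (a : posCompact H) {f : ℝ → ℝ}
    (hf : IsPosVanishing (a : H →L[ℂ] H) f)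
    (h01 : ∀ x ∈ spectrum ℝ (a : H →L[ℂ] H), f x = 0 ∨ f x = 1) :
    ∃ (M : Submodule ℂ H) (_ : FiniteDimensional ℂ M), funCalc a f hf = finiteProj M := by
  set p : H →L[ℂ] H := cfc f (a : H →L[ℂ] H) with hp
  have hp0 : 0 ≤ p := (funCalc a f hf).2.1
  have hidem : p * p = p := by
    rw [hp, ← cfc_mul f f _ hf.continuousOn hf.continuousOn]
    refine cfc_congr fun x hx => ?_
    rcases h01 x hx with h | h <;> simp [h]
  obtain ⟨_, hpr⟩ := isStarProjection_iff_eq_starProjection_range.1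
    (⟨hidem, hp0.isSelfAdjoint⟩ : IsStarProjection p)
  -- The range is fixed by p, so it consists of eigenvectors for 1; any threshold in (0, 1) serves
  -- to get finite dimension from compactness.
  have hle : p.range ≤ spectralSubspace p (Set.Ioi (1 / 2)) := by
    rintro _ ⟨x, rfl⟩
    refine mem_spectralSubspace (μ := 1) (by norm_num) ?_
    rw [Complex.ofReal_one, one_smul]
    exact DFunLike.congr_fun hidem x
  have := finiteDimensional_spectralSubspace hp0 (funCalc a f hf).2.2
    (by norm_num : (0 : ℝ) < 1 / 2)
  have hfin : FiniteDimensional ℂ p.range := Submodule.finiteDimensional_of_le hle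
  exact ⟨p.range, hfin, Subtype.ext hpr⟩

/-- Nonzero spectral points of a compact operator are eigenvalues, and eigenvectors for distinct
ones are independent inside a finite-dimensional spectral subspace. -/
theorem finite_spectrum_inter_Ioi (a : posCompact H) {t : ℝ} (ht : 0 < t) :
    (spectrum ℝ (a : H →L[ℂ] H) ∩ Set.Ioi t).Finite := by
  have heig : ∀ μ : (spectrum ℝ (a : H →L[ℂ] H) ∩ Set.Ioi t : Set ℝ), ∃ x : H,
      Module.End.HasEigenvector ((a : H →L[ℂ] H) : H →ₗ[ℂ] H) ((μ : ℝ) : ℂ) x := by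
    rintro ⟨μ, hμ, hμt⟩
    have h0 : (μ : ℂ) ≠ 0 := Complex.ofReal_ne_zero.2 (ht.trans hμt).ne'
    exact ((IsCompactOperator.hasEigenvalue_iff_mem_spectrum a.2.2 h0).2
      (spectrum.algebraMap_mem ℂ hμ)).exists_hasEigenvector
  choose v hv using heig
  have hli : LinearIndependent ℂ v := Module.End.eigenvectors_linearIndependent' _
    (fun μ : (spectrum ℝ (a : H →L[ℂ] H) ∩ Set.Ioi t : Set ℝ) => ((μ : ℝ) : ℂ))
    (fun _ _ h => Subtype.ext (Complex.ofReal_injective h)) v hv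
  have hmem : ∀ μ, v μ ∈ spectralSubspace (a : H →L[ℂ] H) (Set.Ioi t) := fun μ =>
    mem_spectralSubspace μ.2.2 (hv μ).apply_eq_smul
  have := finiteDimensional_spectralSubspace a.2.1 a.2.2 ht
  have hli' : LinearIndependent ℂ
      (fun μ => (⟨v μ, hmem μ⟩ : spectralSubspace (a : H →L[ℂ] H) (Set.Ioi t))) :=
    LinearIndependent.of_comp (Submodule.subtype _) hli
  have hfin := hli'.finite
  exact Set.toFinite _

/-! ### Functionals are determined by their values on finite-rank projections. -/

variable {φ ψ : posCompact H → ℝ≥0∞}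

theorem IsPosHomogeneous.map_zero (hφ : IsPosHomogeneous φ) : φ 0 = 0 := by
  have := hφ 0 0
  rwa [zero_smul, ENNReal.coe_zero, zero_mul] at this

theorem IsComonotonicAdditive.isMonotoneIncreasingAdditive (hφ : IsComonotonicAdditive φ) :
    IsMonotoneIncreasingAdditive φ := by
  intro a f g hf hg hfm hgm
  refine hφ a f g hf hg fun x hx y hy => ?_
  rcases le_total x y with h | h
  · exact mul_nonneg_of_nonpos_of_nonpos (sub_nonpos.2 (hfm hx hy h)) (sub_nonpos.2 (hgm hx hy h))
  · exact mul_nonneg (sub_nonneg.2 (hfm hy hx h)) (sub_nonneg.2 (hgm hy hx h))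

/-- Functionals that agree on finite-rank projections agree on `f(a)` for increasing `f` with finite
support: such an `f` is the sum of a multiple `min f c` of an indicator function and of
`max (f - c) 0`, which has smaller support. -/
theorem map_funCalc_eq_of_support_finite (hφ : IsMonotoneIncreasingAdditive φ)
    (hφh : IsPosHomogeneous φ) (hψ : IsMonotoneIncreasingAdditive ψ) (hψh : IsPosHomogeneous ψ)
    (heq : ∀ (M : Submodule ℂ H) [FiniteDimensional ℂ M], φ (finiteProj M) = ψ (finiteProj M))
    (a : posCompact H) {f : ℝ → ℝ} (hf : IsPosVanishing (a : H →L[ℂ] H) f)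
    (hmono : MonotoneOn f (spectrum ℝ (a : H →L[ℂ] H)))
    (hfin : {x ∈ spectrum ℝ (a : H →L[ℂ] H) | 0 < f x}.Finite) :
    φ (funCalc a f hf) = ψ (funCalc a f hf) := by
  induction hn : {x ∈ spectrum ℝ (a : H →L[ℂ] H) | 0 < f x}.ncard using
    Nat.strong_induction_on generalizing f with
  | _ n ih =>
    rcases Set.eq_empty_or_nonempty {x ∈ spectrum ℝ (a : H →L[ℂ] H) | 0 < f x} with hS | hS
    · have h0 : funCalc a f hf = 0 := by
        refine Subtype.ext ?_
        show cfc f (a : H →L[ℂ] H) = 0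
        rw [← cfc_zero ℝ (a : H →L[ℂ] H)]
        refine cfc_congr fun x hx => le_antisymm (not_lt.1 fun h => ?_) (hf.nonneg x hx)
        exact Set.eq_empty_iff_forall_notMem.1 hS x ⟨hx, h⟩
      rw [h0, hφh.map_zero, hψh.map_zero]
    -- At the least spectral point m with f positive, monotonicity makes f m the least positive
    -- value of f. Hence min(f / f m, 1) takes only the values 0 and 1, while m leaves the support
    -- of max(f − f m, 0).
    obtain ⟨m, ⟨hm, hm0⟩, hmin⟩ := Set.exists_min_image _ id hfin hS
    have hge : ∀ x ∈ spectrum ℝ (a : H →L[ℂ] H), f x = 0 ∨ f m ≤ f x := by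
      intro x hx
      rcases (hf.nonneg x hx).eq_or_lt with h | h
      · exact Or.inl h.symm
      · exact Or.inr (hmono hm hx (hmin x ⟨hx, h⟩))
    have hg : IsPosVanishing (a : H →L[ℂ] H) (fun x => max (f x - f m) 0) :=
      ⟨(hf.continuousOn.sub continuousOn_const).sup continuousOn_const,
        fun x _ => le_max_right _ _, by simp [hf.map_zero, hm0.le]⟩
    have hgmono : MonotoneOn (fun x => max (f x - f m) 0) (spectrum ℝ (a : H →L[ℂ] H)) :=
      fun x hx y hy hxy => max_le_max (sub_le_sub_right (hmono hx hy hxy) _) le_rfl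
    have hq : IsPosVanishing (a : H →L[ℂ] H) (fun x => min (f x / f m) 1) :=
      ⟨(hf.continuousOn.div_const _).inf continuousOn_const,
        fun x hx => le_min (div_nonneg (hf.nonneg x hx) hm0.le) zero_le_one,
        by simp [hf.map_zero]⟩
    have hh : IsPosVanishing (a : H →L[ℂ] H) (fun x => min (f x) (f m)) :=
      ⟨hf.continuousOn.inf continuousOn_const, fun x hx => le_min (hf.nonneg x hx) hm0.le,
        by simp [hf.map_zero, hm0.le]⟩
    have hhmono : MonotoneOn (fun x => min (f x) (f m)) (spectrum ℝ (a : H →L[ℂ] H)) :=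
      fun x hx y hy hxy => min_le_min (hmono hx hy hxy) le_rfl
    have hsplit : funCalc a f hf = funCalc a _ hg + funCalc a _ hh := by
      rw [← funCalc_add]
      congr 1
      funext x
      rcases le_total (f x) (f m) with h | h
      · simp [h]
      · simp [h]
    obtain ⟨c, hc⟩ : ∃ c : ℝ≥0, (c : ℝ) = f m := ⟨⟨f m, hm0.le⟩, rfl⟩
    have hsmul : funCalc a _ hh = (c • funCalc a _ hq : posCompact H) := by
      refine Subtype.ext ?_
      show cfc (fun x => min (f x) (f m)) (a : H →L[ℂ] H) =
        (c : ℝ) • cfc (fun x => min (f x / f m) 1) (a : H →L[ℂ] H)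
      rw [hc, ← cfc_smul (f m) _ (a : H →L[ℂ] H) hq.continuousOn]
      refine cfc_congr fun x _ => ?_
      show min (f x) (f m) = f m * min (f x / f m) 1
      rw [mul_min_of_nonneg _ _ hm0.le, mul_one, mul_div_cancel₀ _ hm0.ne']
    obtain ⟨M, hM, hproj⟩ := exists_funCalc_eq_finiteProj a hq (fun x hx => by
      rcases hge x hx with h | h
      · left; simp [h]
      · right; exact min_eq_right ((one_le_div hm0).2 h))
    have hsub : {x ∈ spectrum ℝ (a : H →L[ℂ] H) | 0 < max (f x - f m) 0} ⊂
        {x ∈ spectrum ℝ (a : H →L[ℂ] H) | 0 < f x} := by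
      refine ⟨fun x hx => ⟨hx.1, ?_⟩, fun hc => ?_⟩
      · have := hx.2
        simp only [lt_max_iff, lt_self_iff_false, or_false, sub_pos] at this
        exact hm0.trans this
      · have := (hc ⟨hm, hm0⟩).2
        simp at this
    have hrec := ih _ (hn ▸ Set.ncard_lt_ncard hsub hfin) hg hgmono (hfin.subset hsub.subset) rfl
    rw [hsplit, hφ a _ _ hg hh hgmono hhmono, hψ a _ _ hg hh hgmono hhmono, hsmul, hφh, hψh,
      hproj, heq M, hrec]

/-- Only φ needs lower semicontinuity and only ψ monotonicity, so the lemma can be applied again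
with the roles exchanged. -/
theorem le_of_eq_on_finiteProj (hφ : IsMonotoneIncreasingAdditive φ) (hφh : IsPosHomogeneous φ)
    (hφc : LowerSemicontinuous φ) (hψ : IsMonotoneIncreasingAdditive ψ)
    (hψh : IsPosHomogeneous ψ) (hψm : Monotone ψ)
    (heq : ∀ (M : Submodule ℂ H) [FiniteDimensional ℂ M], φ (finiteProj M) = ψ (finiteProj M)) :
    φ ≤ ψ := by
  intro a
  refine le_of_forall_lt_imp_le_of_dense fun y hy => ?_
  obtain ⟨ε, hε, hball⟩ := Metric.eventually_nhds_iff.1 (hφc a y hy)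
  set t := ε / 2 with htdef
  have ht : 0 < t := half_pos hε
  have hspec : ∀ x ∈ spectrum ℝ (a : H →L[ℂ] H), 0 ≤ x := fun x hx =>
    spectrum_nonneg_of_nonneg a.2.1 hx
  have hsa : IsSelfAdjoint (a : H →L[ℂ] H) := a.2.1.isSelfAdjoint
  have hf : IsPosVanishing (a : H →L[ℂ] H) (fun x => max (x - t) 0) :=
    ⟨by fun_prop, fun x _ => le_max_right _ _, by simp [ht.le]⟩
  have hle : funCalc a _ hf ≤ a := by
    show cfc (fun x => max (x - t) 0) (a : H →L[ℂ] H) ≤ a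
    conv_rhs => rw [← cfc_id ℝ (a : H →L[ℂ] H)]
    exact cfc_mono fun x hx => max_le (by simp [ht.le]) (hspec x hx)
  have hdist : dist (funCalc a _ hf) a < ε := by
    rw [Subtype.dist_eq, dist_eq_norm]
    show ‖cfc (fun x => max (x - t) 0) (a : H →L[ℂ] H) - a‖ < ε
    have : cfc (fun x => max (x - t) 0) (a : H →L[ℂ] H) - a =
        cfc (fun x => max (x - t) 0 - id x) (a : H →L[ℂ] H) := by
      rw [cfc_sub _ _ _, cfc_id ℝ (a : H →L[ℂ] H)]
    rw [this]
    refine (norm_cfc_le ht.le fun x hx => ?_).trans_lt (half_lt_self hε)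
    have := hspec x hx
    rw [Real.norm_eq_abs, abs_le, id]
    rcases max_cases (x - t) 0 with ⟨h, _⟩ | ⟨h, _⟩ <;> rw [h] <;> constructor <;> linarith
  -- The chain is y < φ((a − t)₊) = ψ((a − t)₊) ≤ ψ(a); the equality holds because only finitely
  -- many spectral points exceed t.
  refine (hball hdist).le.trans (le_trans (le_of_eq ?_) (hψm hle))
  refine map_funCalc_eq_of_support_finite hφ hφh hψ hψh heq a hf
    (fun x _ y _ hxy => max_le_max (sub_le_sub_right hxy _) le_rfl) ?_
  refine (finite_spectrum_inter_Ioi a ht).subset fun x hx => ⟨hx.1, ?_⟩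
  simpa using hx.2

theorem exists_eq_choquetTrace (hH : ¬ FiniteDimensional ℂ H)
    (hφ : IsMonotoneIncreasingAdditive φ) (hφu : IsUnitarilyInvariant φ) (hφm : Monotone φ)
    (hφh : IsPosHomogeneous φ) (hφc : LowerSemicontinuous φ) (hφf : IsFiniteOnFiniteRank φ) :
    ∃ α : ℕ → ℝ≥0, Monotone α ∧ α 0 = 0 ∧ φ = choquetTrace α := by
  obtain ⟨M, hMmono, hMfin, hMrank⟩ := exists_flag hH
  have hlt : ∀ n, φ (finiteProj (M n)) < ∞ := by
    refine fun n => hφf _ ?_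
    refine Submodule.finiteDimensional_of_le (S₂ := M n) ?_
    rintro _ ⟨x, rfl⟩
    exact (M n).starProjection_apply_mem x
  have hrank : ∀ (N : Submodule ℂ H) [FiniteDimensional ℂ N],
      φ (finiteProj N) = φ (finiteProj (M (Module.finrank ℂ N))) := by
    intro N _
    obtain ⟨u, hu⟩ := exists_unitaryConj_finiteProj_eq (hMrank (Module.finrank ℂ N))
    rw [← hu, hφu]
  set α : ℕ → ℝ≥0 := fun n => (φ (finiteProj (M n))).toNNReal with hα
  have hαcoe : ∀ n, (α n : ℝ≥0∞) = φ (finiteProj (M n)) := fun n =>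
    ENNReal.coe_toNNReal (hlt n).ne
  have hαmono : Monotone α := fun m n hmn =>
    ENNReal.toNNReal_mono (hlt n).ne (hφm (finiteProj_mono (hMmono hmn)))
  have hα0 : α 0 = 0 := by
    have hbot : M 0 = ⊥ := Submodule.finrank_eq_zero.1 (hMrank 0)
    have hzero : finiteProj (M 0) = 0 := by
      refine Subtype.ext ?_
      show (M 0).starProjection = 0
      simp [hbot]
    rw [← ENNReal.coe_eq_zero, hαcoe, hzero, hφh.map_zero]
  have heq : ∀ (N : Submodule ℂ H) [FiniteDimensional ℂ N],
      φ (finiteProj N) = choquetTrace α (finiteProj N) := by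
    intro N _
    rw [choquetTrace_finiteProj hα0, hαcoe, hrank]
  have hψ := (isComonotonicAdditive_choquetTrace (H := H) hαmono hα0).isMonotoneIncreasingAdditive
  have hψh := isPosHomogeneous_choquetTrace (H := H) hαmono hα0
  refine ⟨α, hαmono, hα0, le_antisymm ?_ ?_⟩
  · exact le_of_eq_on_finiteProj hφ hφh hφc hψ hψh (monotone_choquetTrace hαmono hα0) heq
  · exact le_of_eq_on_finiteProj hψ hψh (lowerSemicontinuous_choquetTrace hαmono hα0) hφ hφh hφm
      fun N _ => (heq N).symm

end Uniqueness

end ChoquetTrace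

end

theorem mainTheorem1 {H : Type*} [NormedAddCommGroup H] [InnerProductSpace ℂ H] [CompleteSpace H]
    [TopologicalSpace.SeparableSpace H] (hH : ¬ FiniteDimensional ℂ H)
    (φ : ChoquetTrace.posCompact H → ℝ≥0∞) :
    List.TFAE [
      ∃ α : ℕ → ℝ≥0, Monotone α ∧ α 0 = 0 ∧ φ = ChoquetTrace.choquetTrace α,
      ChoquetTrace.IsMonotoneIncreasingAdditive φ ∧ ChoquetTrace.IsUnitarilyInvariant φ ∧ Monotone φ ∧
        ChoquetTrace.IsPosHomogeneous φ ∧ LowerSemicontinuous φ ∧ ChoquetTrace.IsFiniteOnFiniteRank φ,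
      ChoquetTrace.IsComonotonicAdditive φ ∧ ChoquetTrace.IsUnitarilyInvariant φ ∧ Monotone φ ∧
        ChoquetTrace.IsPosHomogeneous φ ∧ LowerSemicontinuous φ ∧ ChoquetTrace.IsFiniteOnFiniteRank φ] := by
  tfae_have 1 → 3 := by
    rintro ⟨α, hα, hα0, rfl⟩
    exact ⟨ChoquetTrace.isComonotonicAdditive_choquetTrace hα hα0, ChoquetTrace.isUnitarilyInvariant_choquetTrace,
      ChoquetTrace.monotone_choquetTrace hα hα0, ChoquetTrace.isPosHomogeneous_choquetTrace hα hα0,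
      ChoquetTrace.lowerSemicontinuous_choquetTrace hα hα0,
      ChoquetTrace.isFiniteOnFiniteRank_choquetTrace⟩
  tfae_have 3 → 2 := fun h => ⟨h.1.isMonotoneIncreasingAdditive, h.2⟩
  tfae_have 2 → 1 := fun ⟨h, hu, hm, hh, hc, hf⟩ =>
    ChoquetTrace.exists_eq_choquetTrace hH h hu hm hh hc hf
  tfae_finish
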